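/- A $(1,+,\cdot)$-expression is a formal expression built from the constant $1$ using addition and multiplication, with any grouping. For such an expression $E$ let $\mathrm{val}(E)$ be the positive integer it evaluates to, let $\|E\|$ be the number of $1$'s it uses, and let $\delta(E)=\|E\|-3\log_3 \mathrm{val}(E)$. For a positive integer $n$ let the complexity $\|n\|$ be the least $\|E\|$ over all expressions $E$ with $\mathrm{val}(E)=n$, and let the defect of $n$ be $\delta(n)=\|n\|-3\log_3 n$. A positive integer $n$ is called stable if $\|3^k n\|=3k+\|n\|$ for every integer $k\ge 0$. Let $$\mathscr{D}=\{\delta(n): n\ge 1\},\qquad \mathscr{D}_{\mathrm{st}}=\{\delta(n): n\ge 1,\ n \text{ stable}\}.$$ Theorem. With closures taken in $\mathbb{R}$, $$\overline{\mathscr{D}}=\overline{\mathscr{D}_{\mathrm{st}}}=\mathscr{D}+\mathbb{Z}_{\ge 0}=\mathscr{D}_{\mathrm{st}}+\mathbb{Z}_{\ge 0}.$$ Equivalently, this set is $\{k-3\log_3 n : n\ge 1,\ k\in\mathbb{Z},\ k\ge\|n\|\}$, which is also the set of defects $\delta(E)$ of all $(1,+,\cdot)$-expressions $E$. -/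

import Mathlib

open scoped Pointwise

namespace IntegerComplexity

/-- Formal expressions built from the constant one by addition and multiplication, with
arbitrary grouping. -/
inductive Expr : Type
  | one : Expr
  | add : Expr → Expr → Expr
  | mul : Expr → Expr → Expr

namespace Expr

/-- The natural number an expression evaluates to. -/
def val : Expr → ℕ
  | one => 1
  | add a b => a.val + b.val
  | mul a b => a.val * b.val

/-- The complexity of an expression: the number of ones it uses. -/
def complexity : Expr → ℕ
  | one => 1
  | add a b => a.complexity + b.complexity
  | mul a b => a.complexity + b.complexity

/-- The defect of an expression. -/
noncomputable def defect (E : Expr) : ℝ :=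
  (E.complexity : ℝ) - 3 * Real.logb 3 (E.val : ℝ)

/-- Every positive natural number is the value of an expression, so the minimum in
the definition of the complexity of a number is over a nonempty set. -/
theorem exists_val_eq (n : ℕ) (hn : 0 < n) : ∃ E : Expr, E.val = n := by
  induction n, hn using Nat.le_induction with
  | base => exact ⟨one, rfl⟩
  | succ m _ ih =>
    obtain ⟨E, hE⟩ := ih
    exact ⟨add E one, by simp [val, hE]⟩

end Expr

/-- The complexity of a positive natural number `n`: the least number of ones in an
expression with value `n`. (The value at `0`, which no expression has, is never used.) -/
noncomputable def complexity (n : ℕ) : ℕ :=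
  sInf {c : ℕ | ∃ E : Expr, E.val = n ∧ E.complexity = c}

/-- The defect of a positive natural number. -/
noncomputable def defect (n : ℕ) : ℝ :=
  (complexity n : ℝ) - 3 * Real.logb 3 (n : ℝ)

/-- A positive natural number `n` is stable if multiplying it by `3 ^ k` raises the complexity
by exactly `3 * k`, for every `k`. -/
def IsStable (n : ℕ) : Prop :=
  0 < n ∧ ∀ k : ℕ, complexity (3 ^ k * n) = 3 * k + complexity n

/-- The set of all defects of positive natural numbers. -/
def defectSet : Set ℝ := {x | ∃ n : ℕ, 0 < n ∧ x = defect n}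

/-- The set of all stable defects. -/
def stableDefectSet : Set ℝ := {x | ∃ n : ℕ, IsStable n ∧ x = defect n}

/-- The nonnegative integers as a set of real numbers. -/
def nonnegIntegers : Set ℝ := Set.range (fun k : ℕ => (k : ℝ))

end IntegerComplexity

/-! All the sets coincide with the set `R` of expression defects. Stabilizing a value by powers of 3
gives `R` as stable defects plus nonnegative integers, so it remains to show that `R` is closed and
that stable defects are dense in it.

Closedness: by `exists_decomposition`, each defect comes from a tiny value, from a product with both
factors lower by at least `gap`, or from a sum whose larger summand is. Induction on the number of
gaps shows that bounded defects along an ultrafilter are eventually constant or tend to a defect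
plus 1.

Density: for stable `n`, the cost of `3 ^ m * n + 1` inherited from `n` gives values tending to
`defect n + 1` strictly from below. Each is a stable defect plus an integer, constantly `j` along an
ultrafilter. The dichotomy makes `defect n + 1 - j` a defect plus 1, and stability forces `j = 0`.
Iterating reaches every integer shift. -/

open Filter Topology

namespace IntegerComplexity

/-! ### Defects of expressions and the gap above zero -/

namespace Expr

theorem val_pos (E : Expr) : 0 < E.val := by
  induction E with
  | one => exact Nat.one_pos
  | add a b ha _ => exact Nat.add_pos_left ha _
  | mul a b ha hb => exact Nat.mul_pos ha hb

theorem complexity_pos (E : Expr) : 0 < E.complexity := by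
  induction E with
  | one => exact Nat.one_pos
  | add a b ha _ => exact Nat.add_pos_left ha _
  | mul a b ha _ => exact Nat.add_pos_left ha _

theorem val_eq_one_of_complexity_eq_one {E : Expr} (h : E.complexity = 1) : E.val = 1 := by
  cases E with
  | one => rfl
  | add a b =>
    have := a.complexity_pos; have := b.complexity_pos
    simp only [complexity] at h; omega
  | mul a b =>
    have := a.complexity_pos; have := b.complexity_pos
    simp only [complexity] at h; omega

/-- The least positive defect. -/
noncomputable def gap : ℝ := 2 - 3 * Real.logb 3 2

theorem gap_pos : 0 < gap := by
  have h : Real.logb 3 (2 ^ 3) < 2 := by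
    rw [Real.logb_lt_iff_lt_rpow (by norm_num) (by norm_num)]
    norm_num
  rw [Real.logb_pow] at h
  push_cast at h
  unfold gap
  linarith

theorem defect_one : defect one = 1 := by
  simp [defect, complexity, val]

theorem defect_mul (A B : Expr) : defect (mul A B) = defect A + defect B := by
  have ha : (A.val : ℝ) ≠ 0 := by exact_mod_cast A.val_pos.ne'
  have hb : (B.val : ℝ) ≠ 0 := by exact_mod_cast B.val_pos.ne'
  simp only [defect, complexity, val]
  push_cast
  rw [Real.logb_mul ha hb]
  ring

theorem defect_add (A B : Expr) :
    defect (add A B) = defect A + B.complexity - 3 * Real.logb 3 (1 + B.val / A.val) := by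
  have ha : (0 : ℝ) < A.val := by exact_mod_cast A.val_pos
  have hb : (0 : ℝ) < B.val := by exact_mod_cast B.val_pos
  have h : ((A.val : ℝ) + B.val) = A.val * (1 + B.val / A.val) := by field_simp
  simp only [defect, complexity, val]
  push_cast
  rw [h, Real.logb_mul ha.ne' (by positivity)]
  ring

theorem defect_add_comm (A B : Expr) : defect (add A B) = defect (add B A) := by
  simp [defect, complexity, val, add_comm]

theorem logb_ratio_le {A B : Expr} (h : B.val ≤ A.val) :
    Real.logb 3 (1 + B.val / A.val) ≤ Real.logb 3 2 := by
  have ha : (0 : ℝ) < A.val := by exact_mod_cast A.val_pos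
  have hb : (0 : ℝ) < B.val := by exact_mod_cast B.val_pos
  have h' : (B.val : ℝ) / A.val ≤ 1 := by
    rw [div_le_one ha]; exact_mod_cast h
  exact Real.logb_le_logb_of_le (by norm_num) (by positivity) (by linarith)

/-- If `B` costs at least 2, the factor `1 + B / A ≤ 2` cannot recover more than `3 * logb 3 2`. If
`B` is a single 1, that factor is at most `4 / 3`, and the claim reduces to `(4 / 3) ^ 3 * 3 ≤ 2 ^
3`. -/
theorem defect_add_gap_le {A B : Expr} (h : B.val ≤ A.val)
    (h' : 2 ≤ B.complexity ∨ 3 ≤ A.val) : defect A + gap ≤ defect (add A B) := by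
  rw [defect_add]
  have hr := logb_ratio_le h
  by_cases hB : 2 ≤ B.complexity
  · have : (2 : ℝ) ≤ B.complexity := by exact_mod_cast hB
    unfold gap
    linarith
  · have hB1 : B.complexity = 1 := by have := B.complexity_pos; omega
    have hA : (3 : ℝ) ≤ A.val := by exact_mod_cast h'.resolve_left hB
    rw [hB1, val_eq_one_of_complexity_eq_one hB1]
    have h1 : Real.logb 3 (1 + ((1 : ℕ) : ℝ) / A.val) ≤ Real.logb 3 (4 / 3) := by
      refine Real.logb_le_logb_of_le (by norm_num) (by positivity) ?_
      have : (1 : ℝ) / A.val ≤ 1 / 3 := one_div_le_one_div_of_le (by norm_num) hA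
      push_cast; linarith
    have h2 : Real.logb 3 ((4 / 3) ^ 3 * 3) ≤ Real.logb 3 (2 ^ 3) :=
      Real.logb_le_logb_of_le (by norm_num) (by norm_num) (by norm_num)
    rw [Real.logb_mul (by norm_num) (by norm_num), Real.logb_pow, Real.logb_pow,
      Real.logb_self_eq_one (by norm_num)] at h2
    push_cast at h2 ⊢
    unfold gap
    linarith

theorem logb_natCast_three : Real.logb 3 ((3 : ℕ) : ℝ) = 1 := by
  push_cast; exact Real.logb_self_eq_one (by norm_num)

/-- A defect is zero or at least `gap`. -/
theorem defect_eq_zero_or_gap_le (E : Expr) : defect E = 0 ∨ gap ≤ defect E := by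
  have hg := gap_pos
  have nonneg : ∀ {F : Expr}, (defect F = 0 ∨ gap ≤ defect F) → 0 ≤ defect F := by
    rintro F (h | h) <;> linarith
  have key : ∀ A B : Expr, (defect A = 0 ∨ gap ≤ defect A) → B.val ≤ A.val →
      defect (add A B) = 0 ∨ gap ≤ defect (add A B) := by
    intro A B hA h
    by_cases h' : 2 ≤ B.complexity ∨ 3 ≤ A.val
    · have := defect_add_gap_le h h'
      have := nonneg hA
      right; linarith
    · push Not at h'
      have hB1 : B.complexity = 1 := by have := B.complexity_pos; omega
      have hbv := val_eq_one_of_complexity_eq_one hB1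
      have hav := A.val_pos
      obtain ha | ha : A.val = 1 ∨ A.val = 2 := by omega
      · have h1 : (1 : ℝ) ≤ A.complexity := by exact_mod_cast A.complexity_pos
        right
        simp only [defect, gap, complexity, val, ha, hbv, hB1]
        push_cast
        norm_num
        linarith
      · have h1 : 2 ≤ A.complexity := by
          by_contra h
          have := A.complexity_pos
          have := val_eq_one_of_complexity_eq_one (E := A) (by omega)
          omega
        have hd : defect (add A B) = A.complexity - 2 := by
          simp only [defect, complexity, val, ha, hbv, hB1]
          rw [show 2 + 1 = 3 from rfl, logb_natCast_three]
          push_cast; ring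
        rw [hd]
        obtain h2 | h2 := h1.eq_or_lt
        · left; rw [← h2]; norm_num
        · right
          have h3 : (3 : ℝ) ≤ A.complexity := by exact_mod_cast h2
          have h4 : Real.logb 3 (3 ^ 1) ≤ Real.logb 3 (2 ^ 3) :=
            Real.logb_le_logb_of_le (by norm_num) (by norm_num) (by norm_num)
          rw [Real.logb_pow, Real.logb_pow, Real.logb_self_eq_one (by norm_num)] at h4
          push_cast at h4
          unfold gap; linarith
  induction E with
  | one =>
    right
    have h4 : Real.logb 3 (3 ^ 1) ≤ Real.logb 3 (2 ^ 3) :=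
      Real.logb_le_logb_of_le (by norm_num) (by norm_num) (by norm_num)
    rw [Real.logb_pow, Real.logb_pow, Real.logb_self_eq_one (by norm_num)] at h4
    push_cast at h4
    rw [defect_one]; unfold gap; linarith
  | add A B hA hB =>
    rcases le_total B.val A.val with h | h
    · exact key A B hA h
    · rw [defect_add_comm]; exact key B A hB h
  | mul A B hA hB =>
    rw [defect_mul]
    rcases hA with hA | hA
    · simpa [hA] using hB
    · have := nonneg hB
      right; linarith

theorem defect_nonneg (E : Expr) : 0 ≤ defect E := by
  have := gap_pos
  rcases defect_eq_zero_or_gap_le E with h | h <;> linarith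

/-- This leaves finitely many complexities for the smaller summand once the defect is bounded. -/
theorem complexity_le_of_add {A B : Expr} (h : B.val ≤ A.val) :
    (B.complexity : ℝ) ≤ defect (add A B) + 2 := by
  have h1 := defect_add A B
  have h2 := logb_ratio_le h
  have h3 := gap_pos
  have h4 := defect_nonneg A
  unfold gap at h3
  linarith

/-- Up to the value of the defect, an expression is one of small value, a product of two
expressions of smaller defect, or the sum of an expression of smaller defect and another one. -/
theorem exists_decomposition (E : Expr) :
    (∃ F : Expr, defect E = defect F ∧ F.val ≤ 3) ∨
    (∃ A B : Expr, defect E = defect A + defect B ∧ defect A + gap ≤ defect E ∧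
      defect B + gap ≤ defect E) ∨
    (∃ A B : Expr, defect E = defect (add A B) ∧ B.val ≤ A.val ∧
      defect A + gap ≤ defect E) := by
  have key : ∀ A B : Expr, B.val ≤ A.val → (∃ F : Expr, defect (add A B) = defect F ∧ F.val ≤ 3) ∨
      defect A + gap ≤ defect (add A B) := by
    intro A B h
    by_cases h' : 2 ≤ B.complexity ∨ 3 ≤ A.val
    · exact Or.inr (defect_add_gap_le h h')
    · push Not at h'
      have hB1 : B.complexity = 1 := by have := B.complexity_pos; omega
      have hbv := val_eq_one_of_complexity_eq_one hB1
      exact Or.inl ⟨add A B, rfl, by simp only [val]; omega⟩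
  induction E with
  | one => exact Or.inl ⟨one, rfl, by simp [val]⟩
  | add A B _ _ =>
    rcases le_total B.val A.val with h | h
    · exact (key A B h).imp_right fun h' => Or.inr ⟨A, B, rfl, h, h'⟩
    · rw [defect_add_comm]
      exact (key B A h).imp_right fun h' => Or.inr ⟨B, A, rfl, h, h'⟩
  | mul A B hA hB =>
    rw [defect_mul]
    rcases defect_eq_zero_or_gap_le A with h1 | h1
    · simpa only [h1, zero_add] using hB
    · rcases defect_eq_zero_or_gap_le B with h2 | h2
      · simpa only [h2, add_zero] using hA
      · exact Or.inr (Or.inl ⟨A, B, rfl, by linarith, by linarith⟩)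

theorem exists_defect_eq_add_natCast (E : Expr) (k : ℕ) : ∃ F : Expr, defect F = defect E + k := by
  induction k with
  | zero => exact ⟨E, by simp⟩
  | succ k ih =>
    obtain ⟨F, hF⟩ := ih
    exact ⟨mul F one, by rw [defect_mul, hF, defect_one]; push_cast; ring⟩

end Expr

/-! ### Limits of defects along ultrafilters -/

theorem eventually_eq_const_of_le {α : Type*} (U : Ultrafilter α) (f : α → ℕ) (M : ℕ)
    (h : ∀ᶠ x in U, f x ≤ M) : ∃ c, ∀ᶠ x in U, f x = c := by
  have := (Ultrafilter.eventually_exists_mem_iff (f := U) (is := Set.Iic M) (P := fun c x => f x = c)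
    (Set.finite_Iic M)).1 (h.mono fun x hx => ⟨f x, hx, rfl⟩)
  obtain ⟨c, -, hc⟩ := this
  exact ⟨c, hc⟩

/-- Bounds on value and defect bound the complexity, so only finitely many pairs (value, complexity)
occur. -/
theorem eventually_defect_eq_const {α : Type*} (U : Ultrafilter α) (F : α → Expr) (s : ℝ) (M : ℕ)
    (hs : ∀ᶠ x in U, (F x).defect ≤ s) (hM : ∀ᶠ x in U, (F x).val ≤ M) :
    ∃ E : Expr, ∀ᶠ x in U, (F x).defect = E.defect := by
  obtain ⟨v, hv⟩ := eventually_eq_const_of_le U (fun x => (F x).val) M hM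
  obtain ⟨c, hc⟩ := eventually_eq_const_of_le U (fun x => (F x).complexity)
    ⌈s + 3 * Real.logb 3 v⌉₊ (by
      filter_upwards [hs, hv] with x hx hx'
      have : ((F x).complexity : ℝ) ≤ s + 3 * Real.logb 3 v := by
        unfold Expr.defect at hx
        rw [hx'] at hx
        linarith
      exact_mod_cast this.trans (Nat.le_ceil _))
  obtain ⟨x₀, h₀, h₀'⟩ := (hv.and hc).exists
  refine ⟨F x₀, ?_⟩
  filter_upwards [hv, hc] with x hx hx'
  simp only [Expr.defect, hx, hx', h₀, h₀']

/-- Along an ultrafilter on which they are bounded, defects of expressions are either eventually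
constant, or converge to the successor of a defect. -/
theorem eventually_const_or_tendsto_of_lt {α : Type*} (U : Ultrafilter α) (n : ℕ) (F : α → Expr)
    (hF : ∀ᶠ x in U, (F x).defect < n * Expr.gap) :
    (∃ E : Expr, ∀ᶠ x in U, (F x).defect = E.defect) ∨
    ∃ E : Expr, Tendsto (fun x => (F x).defect) U (𝓝 (E.defect + 1)) := by
  induction n generalizing F with
  | zero =>
    obtain ⟨x, hx⟩ := hF.exists
    have := (F x).defect_nonneg
    simp at hx; linarith
  | succ n ih =>
    have hdec := (Eventually.of_forall (f := (U : Filter α))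
      fun x => (F x).exists_decomposition)
    -- The ultrafilter selects one shape of decomposition for all relevant indices.
    rw [Ultrafilter.eventually_or, Ultrafilter.eventually_or] at hdec
    push_cast at hF
    rcases hdec with h | h | h
    · obtain ⟨G, hG⟩ := h.choice
      obtain ⟨E, hE⟩ := eventually_defect_eq_const U G ((n + 1) * Expr.gap) 3
        (by filter_upwards [hF, hG] with x h1 h2; rw [← h2.1]; exact h1.le)
        (hG.mono fun x h => h.2)
      left
      refine ⟨E, ?_⟩
      filter_upwards [hG, hE] with x h1 h2
      rw [h1.1, h2]
    · obtain ⟨A, hA⟩ := h.choice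
      obtain ⟨B, hB⟩ := hA.choice
      have hsum : (fun x => (F x).defect) =ᶠ[U] fun x => (A x).defect + (B x).defect :=
        hB.mono fun x h => h.1
      have h1 := ih A (by filter_upwards [hF, hB] with x h1 h2; linarith [h2.2.1])
      have h2 := ih B (by filter_upwards [hF, hB] with x h1 h2; linarith [h2.2.2])
      have key : ∀ E₁ E₂ : Expr, Tendsto (fun x => (A x).defect + (B x).defect) U
          (𝓝 (E₁.defect + E₂.defect + 1)) → ∃ E : Expr, Tendsto (fun x => (F x).defect) U
          (𝓝 (E.defect + 1)) := fun E₁ E₂ h =>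
        ⟨.mul E₁ E₂, by rw [Expr.defect_mul]; exact h.congr' hsum.symm⟩
      rcases h1 with ⟨E₁, h1⟩ | ⟨E₁, h1⟩ <;> rcases h2 with ⟨E₂, h2⟩ | ⟨E₂, h2⟩
      · left
        refine ⟨.mul E₁ E₂, ?_⟩
        filter_upwards [hsum, h1, h2] with x h h1 h2
        rw [h, h1, h2, Expr.defect_mul]
      · right
        refine key E₁ E₂ ?_
        rw [add_assoc]
        exact (tendsto_nhds_of_eventually_eq h1).add h2
      · right
        refine key E₁ E₂ ?_
        rw [add_right_comm]
        exact h1.add (tendsto_nhds_of_eventually_eq h2)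
      · right
        -- The limit carries two units; one is absorbed into an expression.
        obtain ⟨E, hE⟩ := Expr.exists_defect_eq_add_natCast E₁ 1
        refine key E E₂ ?_
        rw [hE, Nat.cast_one, add_assoc]
        exact h1.add h2
    · obtain ⟨A, hA⟩ := h.choice
      obtain ⟨B, hB⟩ := hA.choice
      have h1 := ih A (by filter_upwards [hF, hB] with x h1 h2; linarith [h2.2.2])
      have hlim : ∃ E : Expr, Tendsto (fun x => (A x).defect) U (𝓝 E.defect) := by
        rcases h1 with ⟨E, h1⟩ | ⟨E, h1⟩
        · exact ⟨E, tendsto_nhds_of_eventually_eq h1⟩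
        · obtain ⟨E', hE'⟩ := Expr.exists_defect_eq_add_natCast E 1
          exact ⟨E', by rw [hE', Nat.cast_one]; exact h1⟩
      obtain ⟨E, hE⟩ := hlim
      by_cases hbd : ∃ M : ℕ, ∀ᶠ x in U, (A x).val ≤ M
      · left
        obtain ⟨M, hM⟩ := hbd
        obtain ⟨E, hE⟩ := eventually_defect_eq_const U (fun x => .add (A x) (B x))
          ((n + 1) * Expr.gap) (M + M)
          (by filter_upwards [hF, hB] with x h1 h2; rw [← h2.1]; exact h1.le)
          (by filter_upwards [hM, hB] with x h1 h2; simp only [Expr.val]; omega)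
        refine ⟨E, ?_⟩
        filter_upwards [hB, hE] with x h1 h2
        rw [h1.1, h2]
      · right
        -- For an ultrafilter, not being eventually bounded already means tending to infinity. The
        -- correction `logb 3 (1 + B / A)` then vanishes.
        have htop : Tendsto (fun x => ((A x).val : ℝ)) U atTop := by
          refine tendsto_natCast_atTop_atTop.comp (tendsto_atTop.2 fun M => ?_)
          by_contra h
          rw [← Ultrafilter.eventually_not] at h
          exact hbd ⟨M, h.mono fun x hx => (not_le.1 hx).le⟩
        obtain ⟨k, hk⟩ := eventually_eq_const_of_le U (fun x => (B x).complexity)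
          ⌈(n + 1) * Expr.gap + 2⌉₊ (by
            filter_upwards [hF, hB] with x h1 h2
            have h3 := Expr.complexity_le_of_add h2.2.1
            rw [← h2.1] at h3
            have : ((B x).complexity : ℝ) ≤ (n + 1) * Expr.gap + 2 := by linarith
            exact_mod_cast this.trans (Nat.le_ceil _))
        obtain ⟨M, hM⟩ : ∃ M : ℝ, ∀ᶠ x in U, ((B x).val : ℝ) ≤ M := by
          refine ⟨(3 : ℝ) ^ (k : ℝ), hk.mono fun x hx => ?_⟩
          have hv : (1 : ℝ) ≤ (B x).val := by exact_mod_cast (B x).val_pos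
          rw [← Real.logb_le_iff_le_rpow (by norm_num) (by linarith)]
          have h1 := (B x).defect_nonneg
          have h2 : 0 ≤ Real.logb 3 (B x).val := Real.logb_nonneg (by norm_num) hv
          unfold Expr.defect at h1
          rw [hx] at h1
          linarith
        have hratio : Tendsto (fun x => ((B x).val : ℝ) / (A x).val) U (𝓝 0) := by
          refine tendsto_of_tendsto_of_tendsto_of_le_of_le' tendsto_const_nhds
            (htop.const_div_atTop M) (Eventually.of_forall fun x => by positivity) ?_
          filter_upwards [hM] with x hx
          gcongr
        have hlog : Tendsto (fun x => Real.logb 3 (1 + (B x).val / (A x).val)) U (𝓝 0) := by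
          have := (Real.continuousAt_logb (b := 3) one_ne_zero).tendsto.comp
            (by simpa using hratio.const_add 1 :
              Tendsto (fun x => 1 + ((B x).val : ℝ) / (A x).val) U (𝓝 1))
          simpa [Function.comp_def] using this
        obtain ⟨x₀, hx₀⟩ := hk.exists
        -- One of the ones in `B` supplies the `+ 1` of the limit; the other `j` go into `E'`.
        obtain ⟨j, rfl⟩ : ∃ j, k = j + 1 :=
          Nat.exists_eq_succ_of_ne_zero (hx₀ ▸ (B x₀).complexity_pos.ne')
        obtain ⟨E', hE'⟩ := Expr.exists_defect_eq_add_natCast E j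
        refine ⟨E', ?_⟩
        have hl : E'.defect + 1 = E.defect + ((j + 1 : ℕ) : ℝ) - 3 * 0 := by
          rw [hE']; push_cast; ring
        rw [hl]
        refine ((hE.add_const _).sub (hlog.const_mul 3)).congr' ?_
        filter_upwards [hB, hk] with x h1 h2
        rw [h1.1, Expr.defect_add, h2]

theorem eventually_const_or_tendsto {α : Type*} (U : Ultrafilter α) (F : α → Expr) (s : ℝ)
    (hF : ∀ᶠ x in U, (F x).defect ≤ s) :
    (∃ E : Expr, ∀ᶠ x in U, (F x).defect = E.defect) ∨
    ∃ E : Expr, Tendsto (fun x => (F x).defect) U (𝓝 (E.defect + 1)) := by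
  obtain ⟨n, hn⟩ := exists_nat_gt (s / Expr.gap)
  rw [div_lt_iff₀ Expr.gap_pos] at hn
  exact eventually_const_or_tendsto_of_lt U n F (hF.mono fun x hx => hx.trans_lt hn)

/-- The set of defects of expressions is closed. -/
theorem isClosed_range_defect : IsClosed (Set.range Expr.defect) := by
  refine isClosed_of_closure_subset fun x hx => ?_
  have hne : NeBot (comap Expr.defect (𝓝 x)) :=
    comap_neBot_iff_frequently.2 (mem_closure_iff_frequently.1 hx)
  let U := Ultrafilter.of (comap Expr.defect (𝓝 x))
  have hU : Tendsto Expr.defect U (𝓝 x) := tendsto_comap.mono_left (Ultrafilter.of_le _)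
  rcases eventually_const_or_tendsto U id (x + 1)
    (hU.eventually (eventually_le_nhds (lt_add_one x))) with ⟨E, h⟩ | ⟨E, h⟩
  · exact ⟨E, tendsto_nhds_unique (tendsto_nhds_of_eventually_eq h) hU⟩
  · obtain ⟨E', hE'⟩ := E.exists_defect_eq_add_natCast 1
    refine ⟨E', ?_⟩
    rw [hE', Nat.cast_one]
    exact tendsto_nhds_unique h hU

/-! ### Complexity of numbers and stabilization -/

theorem complexity_val_le (E : Expr) : complexity E.val ≤ E.complexity :=
  Nat.sInf_le ⟨E, rfl, rfl⟩

theorem exists_expr {n : ℕ} (hn : 0 < n) : ∃ E : Expr, E.val = n ∧ E.complexity = complexity n := by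
  obtain ⟨E, hE⟩ := Expr.exists_val_eq n hn
  exact Nat.sInf_mem (s := {c : ℕ | ∃ E : Expr, E.val = n ∧ E.complexity = c}) ⟨_, E, hE, rfl⟩

theorem exists_expr_defect_eq {n : ℕ} (hn : 0 < n) :
    ∃ E : Expr, E.val = n ∧ E.defect = defect n := by
  obtain ⟨E, hE, hE'⟩ := exists_expr hn
  exact ⟨E, hE, by rw [Expr.defect, defect, hE, hE']⟩

theorem complexity_mul_le {m n : ℕ} (hm : 0 < m) (hn : 0 < n) :
    complexity (m * n) ≤ complexity m + complexity n := by
  obtain ⟨E, rfl, hE⟩ := exists_expr hm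
  obtain ⟨F, rfl, hF⟩ := exists_expr hn
  rw [← hE, ← hF]
  exact complexity_val_le (.mul E F)

theorem complexity_succ_le {n : ℕ} (hn : 0 < n) : complexity (n + 1) ≤ complexity n + 1 := by
  obtain ⟨E, rfl, hE⟩ := exists_expr hn
  rw [← hE]
  exact complexity_val_le (.add E .one)

theorem complexity_three_pow_mul_le {n : ℕ} (hn : 0 < n) (k : ℕ) :
    complexity (3 ^ k * n) ≤ 3 * k + complexity n := by
  induction k with
  | zero => simp
  | succ k ih =>
    have h1 := complexity_mul_le (m := 3) (n := 3 ^ k * n) (by norm_num) (by positivity)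
    have h2 : complexity 3 ≤ 3 := complexity_val_le (.add (.add .one .one) .one)
    rw [pow_succ', mul_assoc]
    omega

theorem logb_three_pow_mul {n : ℕ} (hn : 0 < n) (k : ℕ) :
    Real.logb 3 ((3 ^ k * n : ℕ) : ℝ) = k + Real.logb 3 n := by
  have : (n : ℝ) ≠ 0 := by exact_mod_cast hn.ne'
  push_cast
  rw [Real.logb_mul (by positivity) this, Real.logb_pow, Real.logb_self_eq_one (by norm_num),
    mul_one]

theorem three_mul_le_complexity {n : ℕ} (hn : 0 < n) (k : ℕ) :
    3 * k ≤ complexity (3 ^ k * n) := by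
  obtain ⟨E, hE, hE'⟩ := exists_expr_defect_eq (n := 3 ^ k * n) (by positivity)
  have h := E.defect_nonneg
  rw [hE', defect, logb_three_pow_mul hn] at h
  have h1 : 0 ≤ Real.logb 3 n := Real.logb_nonneg (by norm_num) (by exact_mod_cast hn)
  have : (3 * k : ℝ) ≤ complexity (3 ^ k * n) := by linarith
  exact_mod_cast this

/-- Every positive number becomes stable after multiplication by a power of three. -/
theorem exists_isStable {n : ℕ} (hn : 0 < n) : ∃ K : ℕ, IsStable (3 ^ K * n) := by
  -- The subtraction is truncated, but `three_mul_le_complexity` makes it exact.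
  obtain ⟨K, hK⟩ : ∃ K, ∀ k, complexity (3 ^ K * n) - 3 * K ≤ complexity (3 ^ k * n) - 3 * k :=
    ⟨Function.argmin fun k => complexity (3 ^ k * n) - 3 * k,
      fun k => Function.argmin_le (fun k => complexity (3 ^ k * n) - 3 * k) k⟩
  have hp : 0 < 3 ^ K * n := by positivity
  refine ⟨K, hp, fun k => le_antisymm (complexity_three_pow_mul_le hp k) ?_⟩
  have h1 := hK (k + K)
  have h2 := three_mul_le_complexity hn (k + K)
  have h3 := three_mul_le_complexity hn K
  rw [← mul_assoc, ← pow_add]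
  omega

theorem exists_isStable_defect_eq {n : ℕ} (hn : 0 < n) {c : ℕ} (hc : complexity n ≤ c) :
    ∃ m i : ℕ, IsStable m ∧ (c : ℝ) - 3 * Real.logb 3 n = defect m + i := by
  obtain ⟨K, hK⟩ := exists_isStable hn
  have h1 := complexity_three_pow_mul_le hn K
  refine ⟨3 ^ K * n, 3 * K + c - complexity (3 ^ K * n), hK, ?_⟩
  rw [defect, logb_three_pow_mul hn, Nat.cast_sub (by omega)]
  push_cast
  ring

theorem exists_three_pow_mul_eq_of_le {v n p q : ℕ} (hn : 0 < n) (hpq : p ≤ q)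
    (h : 3 ^ p * v ^ 3 = 3 ^ q * n ^ 3) : ∃ t, v = 3 ^ t * n := by
  obtain ⟨r, rfl⟩ := Nat.exists_eq_add_of_le hpq
  rw [pow_add, mul_assoc] at h
  have h' := Nat.eq_of_mul_eq_mul_left (by positivity) h
  obtain ⟨w, rfl⟩ : n ∣ v := (Nat.pow_dvd_pow_iff (n := 3) (by norm_num)).1 ⟨3 ^ r, by rw [h']; ring⟩
  rw [mul_pow, mul_comm] at h'
  have hw := Nat.eq_of_mul_eq_mul_right (by positivity) h'
  obtain ⟨t, -, rfl⟩ := (Nat.dvd_prime_pow Nat.prime_three).1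
    (hw ▸ dvd_pow_self w (by norm_num) : w ∣ 3 ^ r)
  exact ⟨t, mul_comm _ _⟩

/-- Defects differing by an integer force values differing by a power of 3: exponentiating gives `3
^ p * v ^ 3 = 3 ^ q * n ^ 3`. -/
theorem exists_three_pow_mul_eq {v n p q : ℕ} (hv : 0 < v) (hn : 0 < n)
    (h : p + 3 * Real.logb 3 v = q + 3 * Real.logb 3 n) :
    ∃ s t, 3 ^ s * v = 3 ^ t * n := by
  have hv' : (0 : ℝ) < v := by exact_mod_cast hv
  have hn' : (0 : ℝ) < n := by exact_mod_cast hn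
  have hlog : ∀ {x : ℝ} (k : ℕ), 0 < x → Real.logb 3 (3 ^ k * x ^ 3) = k + 3 * Real.logb 3 x := by
    intro x k hx
    rw [Real.logb_mul (by positivity) (by positivity), Real.logb_pow, Real.logb_pow,
      Real.logb_self_eq_one (by norm_num)]
    push_cast; ring
  have h' : 3 ^ p * v ^ 3 = 3 ^ q * n ^ 3 := by
    have : (3 : ℝ) ^ p * v ^ 3 = 3 ^ q * n ^ 3 := by
      refine Real.logb_injOn_pos (b := 3) (by norm_num) (Set.mem_Ioi.2 (by positivity))
        (Set.mem_Ioi.2 (by positivity)) ?_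
      rw [hlog p hv', hlog q hn', h]
    exact_mod_cast this
  rcases le_total p q with hpq | hpq
  · obtain ⟨t, ht⟩ := exists_three_pow_mul_eq_of_le hn hpq h'
    exact ⟨0, t, by simpa using ht⟩
  · obtain ⟨t, ht⟩ := exists_three_pow_mul_eq_of_le hv hpq h'.symm
    exact ⟨t, 0, by simpa using ht.symm⟩

/-- A stable defect cannot be lowered by a positive integer to another defect. -/
theorem IsStable.eq_zero_of_defect_add_eq {n : ℕ} (hn : IsStable n) {E : Expr} {i : ℕ}
    (h : E.defect + i = defect n) : i = 0 := by
  have hv := E.val_pos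
  obtain ⟨s, t, hst⟩ := exists_three_pow_mul_eq (p := complexity n) (q := E.complexity + i) hv hn.1
    (by unfold Expr.defect defect at h; push_cast; linarith)
  have h1 := complexity_three_pow_mul_le hv s
  have h2 := complexity_val_le E
  have h3 := hn.2 t
  have h4 : (s : ℝ) + Real.logb 3 E.val = t + Real.logb 3 n := by
    rw [← logb_three_pow_mul hv, ← logb_three_pow_mul hn.1, hst]
  rw [hst] at h1
  have h5 : (3 * t + complexity n : ℝ) ≤ 3 * s + E.complexity := by exact_mod_cast (by omega)
  unfold Expr.defect defect at h
  have h6 : (i : ℝ) ≤ 0 := by linarith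
  exact_mod_cast le_antisymm h6 i.cast_nonneg

/-! ### Density of the stable defects -/

theorem IsStable.defect_add_one_mem_closure {n : ℕ} (hn : IsStable n) :
    defect n + 1 ∈ closure stableDefectSet := by
  have hn0 : (0 : ℝ) < n := by exact_mod_cast hn.1
  have hstep : ∀ m : ℕ, complexity (3 ^ m * n + 1) ≤ 3 * m + complexity n + 1 := fun m =>
    (complexity_succ_le (by have := hn.1; positivity)).trans
      (Nat.succ_le_succ (complexity_three_pow_mul_le hn.1 m))
  choose N i hN hi using fun m : ℕ => exists_isStable_defect_eq (Nat.succ_pos _) (hstep m)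
  choose F _ hF using fun m => exists_expr_defect_eq (hN m).1
  have hy : ∀ m, defect (N m) + i m =
      defect n + 1 - 3 * Real.logb 3 (1 + 1 / (3 ^ m * n : ℝ)) := by
    intro m
    have h1 : (((3 ^ m * n).succ : ℕ) : ℝ) = ((3 ^ m * n : ℕ) : ℝ) * (1 + 1 / (3 ^ m * n : ℝ)) := by
      push_cast; field_simp
    rw [← hi, h1, Real.logb_mul (by push_cast; positivity) (by positivity),
      logb_three_pow_mul hn.1, defect]
    push_cast
    ring
  have hlt : ∀ m, defect (N m) + i m < defect n + 1 := by
    intro m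
    have : 0 < Real.logb 3 (1 + 1 / (3 ^ m * n : ℝ)) :=
      Real.logb_pos (by norm_num) (lt_add_of_pos_right _ (by positivity))
    rw [hy]; linarith
  have hnonneg : ∀ m, 0 ≤ defect (N m) := fun m => hF m ▸ (F m).defect_nonneg
  have hlim : Tendsto (fun m => defect (N m) + i m) (hyperfilter ℕ) (𝓝 (defect n + 1)) := by
    have h1 : Tendsto (fun m : ℕ => (3 ^ m * n : ℝ)) atTop atTop :=
      (tendsto_pow_atTop_atTop_of_one_lt (by norm_num)).atTop_mul_const hn0
    have h2 : Tendsto (fun m : ℕ => 1 + 1 / (3 ^ m * n : ℝ)) atTop (𝓝 1) := by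
      simpa using (h1.const_div_atTop 1).const_add 1
    have h3 := ((Real.continuousAt_logb (b := 3) one_ne_zero).tendsto.comp h2).const_mul 3
    have h4 := (h3.const_sub (defect n + 1)).mono_left Nat.hyperfilter_le_atTop
    simpa [hy] using h4
  obtain ⟨j, hj⟩ := eventually_eq_const_of_le (hyperfilter ℕ) i ⌈defect n + 1⌉₊
    (Eventually.of_forall fun m => by
      have : (i m : ℝ) ≤ defect n + 1 := by linarith [hlt m, hnonneg m]
      exact_mod_cast this.trans (Nat.le_ceil _))
  have hlim' : Tendsto (fun m => (F m).defect) (hyperfilter ℕ) (𝓝 (defect n + 1 - j)) := by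
    refine (hlim.sub_const (j : ℝ)).congr' ?_
    filter_upwards [hj] with m hm
    rw [hF, hm]; ring
  -- An eventually constant sequence would attain its limit, contradicting `hlt`. Otherwise the
  -- limit is `E.defect + 1`, so `E.defect + j = defect n`.
  have hj0 : j = 0 := by
    rcases eventually_const_or_tendsto (hyperfilter ℕ) F (defect n + 1)
      (Eventually.of_forall fun m => by
        have : (0 : ℝ) ≤ i m := Nat.cast_nonneg _
        linarith [hlt m, hF m]) with ⟨E, h⟩ | ⟨E, h⟩
    · have h1 := tendsto_nhds_unique (tendsto_nhds_of_eventually_eq h) hlim'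
      obtain ⟨m, hm, hm'⟩ := (h.and hj).exists
      have := hlt m
      rw [hm', ← hF, hm] at this
      linarith
    · have h1 := tendsto_nhds_unique h hlim'
      exact hn.eq_zero_of_defect_add_eq (E := E) (by linarith)
  rw [hj0, Nat.cast_zero, sub_zero] at hlim'
  exact mem_closure_of_tendsto hlim' (Eventually.of_forall fun m => ⟨N m, hN m, hF m⟩)

theorem add_natCast_mem_closure_stableDefectSet {x : ℝ} (hx : x ∈ closure stableDefectSet) (k : ℕ) :
    x + k ∈ closure stableDefectSet := by
  induction k with
  | zero => simpa using hx
  | succ k ih =>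
    have := map_mem_closure (f := fun y : ℝ => y + 1) (t := closure stableDefectSet)
      (by fun_prop) ih (by rintro _ ⟨n, hn, rfl⟩; exact hn.defect_add_one_mem_closure)
    rw [closure_closure] at this
    push_cast
    rwa [← add_assoc]

/-! ### Identification of all the sets -/

theorem stableDefectSet_subset_defectSet : stableDefectSet ⊆ defectSet := by
  rintro _ ⟨n, hn, rfl⟩
  exact ⟨n, hn.1, rfl⟩

theorem defectSet_subset_range : defectSet ⊆ Set.range Expr.defect := by
  rintro _ ⟨n, hn, rfl⟩
  obtain ⟨E, -, hE⟩ := exists_expr_defect_eq hn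
  exact ⟨E, hE⟩

theorem defectSet_add_nonnegIntegers_subset_range :
    defectSet + nonnegIntegers ⊆ Set.range Expr.defect := by
  rintro _ ⟨_, hx, _, ⟨k, rfl⟩, rfl⟩
  obtain ⟨E, rfl⟩ := defectSet_subset_range hx
  exact E.exists_defect_eq_add_natCast k

theorem range_subset_stableDefectSet_add :
    Set.range Expr.defect ⊆ stableDefectSet + nonnegIntegers := by
  rintro _ ⟨E, rfl⟩
  obtain ⟨m, i, hm, h⟩ := exists_isStable_defect_eq E.val_pos (complexity_val_le E)
  exact ⟨_, ⟨m, hm, rfl⟩, _, ⟨i, rfl⟩, h.symm⟩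

theorem stableDefectSet_add_nonnegIntegers :
    stableDefectSet + nonnegIntegers = Set.range Expr.defect :=
  ((Set.add_subset_add_right stableDefectSet_subset_defectSet).trans
    defectSet_add_nonnegIntegers_subset_range).antisymm range_subset_stableDefectSet_add

theorem defectSet_add_nonnegIntegers : defectSet + nonnegIntegers = Set.range Expr.defect :=
  defectSet_add_nonnegIntegers_subset_range.antisymm
    (range_subset_stableDefectSet_add.trans
      (Set.add_subset_add_right stableDefectSet_subset_defectSet))

theorem range_subset_closure_stableDefectSet :
    Set.range Expr.defect ⊆ closure stableDefectSet := by
  rw [← stableDefectSet_add_nonnegIntegers]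
  rintro _ ⟨x, hx, _, ⟨k, rfl⟩, rfl⟩
  exact add_natCast_mem_closure_stableDefectSet (subset_closure hx) k

theorem closure_defectSet : closure defectSet = Set.range Expr.defect :=
  (closure_minimal defectSet_subset_range isClosed_range_defect).antisymm
    (range_subset_closure_stableDefectSet.trans (closure_mono stableDefectSet_subset_defectSet))

theorem closure_stableDefectSet : closure stableDefectSet = Set.range Expr.defect :=
  (closure_minimal (stableDefectSet_subset_defectSet.trans defectSet_subset_range)
    isClosed_range_defect).antisymm range_subset_closure_stableDefectSet

theorem range_defect_eq : Set.range Expr.defect =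
    {x : ℝ | ∃ n k : ℕ, 0 < n ∧ complexity n ≤ k ∧ x = (k : ℝ) - 3 * Real.logb 3 (n : ℝ)} := by
  ext x
  constructor
  · rintro ⟨E, rfl⟩
    exact ⟨E.val, E.complexity, E.val_pos, complexity_val_le E, rfl⟩
  · rintro ⟨n, k, hn, hk, rfl⟩
    obtain ⟨m, i, hm, h⟩ := exists_isStable_defect_eq hn hk
    rw [h, ← stableDefectSet_add_nonnegIntegers]
    exact ⟨_, ⟨m, hm, rfl⟩, _, ⟨i, rfl⟩, rfl⟩

end IntegerComplexity

theorem mainTheorem5 :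
    closure IntegerComplexity.defectSet = closure IntegerComplexity.stableDefectSet ∧
    closure IntegerComplexity.stableDefectSet =
      IntegerComplexity.defectSet + IntegerComplexity.nonnegIntegers ∧
    IntegerComplexity.defectSet + IntegerComplexity.nonnegIntegers =
      IntegerComplexity.stableDefectSet + IntegerComplexity.nonnegIntegers ∧
    closure IntegerComplexity.defectSet =
      {x : ℝ | ∃ n k : ℕ, 0 < n ∧ IntegerComplexity.complexity n ≤ k ∧
        x = (k : ℝ) - 3 * Real.logb 3 (n : ℝ)} ∧
    closure IntegerComplexity.defectSet = Set.range IntegerComplexity.Expr.defect := by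
  open IntegerComplexity in
  exact ⟨closure_defectSet.trans closure_stableDefectSet.symm,
    closure_stableDefectSet.trans defectSet_add_nonnegIntegers.symm,
    defectSet_add_nonnegIntegers.trans stableDefectSet_add_nonnegIntegers.symm,
    closure_defectSet.trans range_defect_eq, closure_defectSet⟩
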